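/- Let $(\mathfrak h_{\mathbb Z}^*, R, \mathfrak h_{\mathbb Z}, R^\vee)$ be a reduced root datum ($\mathfrak h_{\mathbb Z}^*,\mathfrak h_{\mathbb Z}$ lattices of finite rank, $R$ finite) with pairing $\langle\cdot,\cdot\rangle$, simple roots $\alpha_1,\dots,\alpha_n$, positive roots $R_+$, simple reflections $s_i=s_{\alpha_i}$ and finite Weyl group $W_0=\langle s_1,\dots,s_n\rangle$. Let $\mathbb K$ be a field and let $t_1^{1/2},\dots,t_n^{1/2}\in\mathbb K$ be nonzero, with $t_i^{1/2}=t_j^{1/2}$ whenever $s_i$ and $s_j$ are conjugate; put $t_i=(t_i^{1/2})^2$. For $\alpha\in R$ put $t_{\alpha^\vee}^{1/2}=t_\alpha^{1/2}=t_i^{1/2}$ if $\alpha\in W_0\alpha_i$, and $t_{\alpha^\vee}=t_\alpha=(t_\alpha^{1/2})^2$. For $w\in W_0$ put $t_w=t_{i_1}\cdots t_{i_r}$ and $t_w^{1/2}=t_{i_1}^{1/2}\cdots t_{i_r}^{1/2}$, where $w=s_{i_1}\cdots s_{i_r}$ is a reduced expression. For a coroot $\beta^\vee$ put $$t^{\mathrm{ht}(\beta^\vee)}=\prod_{\alpha\in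 R_+}\bigl(t_\alpha^{1/2}\bigr)^{\langle\alpha,\beta^\vee\rangle}.$$ For $v,w\in W_0$ let $\mathcal L(w)$ be the set of positive coroots $\alpha^\vee$ such that $w^{-1}\alpha^\vee$ is negative, let $\mathcal L(v,w)=(\mathcal L(v)\cup\mathcal L(w))\setminus(\mathcal L(v)\cap\mathcal L(w))$, and let $\ell(w)=|\mathcal L(w)|$. Let $\mu\in\mathfrak h_{\mathbb Z}^*$ be dominant, i.e. $\langle\mu,\alpha_i^\vee\rangle\ge 0$ for $i=1,\dots,n$. Let $W_\mu\subseteq W_0$ be its stabilizer, $w_\mu$ the longest element of $W_\mu$ (with respect to $\ell$), and $W_\mu(t)=\sum_{u\in W_\mu}t_u$ the Poincaré polynomial of $W_\mu$. Assume that $t^{\mathrm{ht}(-\alpha^\vee)}\neq 1$ for all $\alpha^\vee\in\mathcal L(1,w_\mu)$. Then $$\sum_{u\in W_\mu}\left(\prod_{\alpha^\vee\in\mathcal L(1,u)}t_{\alpha^\vee}^{\frac12}\,\frac{1-t^{\mathrm{ht}(-\alpha^\vee)}t_{\alpha^\vee}^{-1}}{1-t^{\mathrm{ht}(-\alpha^\vee)}}\right)\left(\prod_{\alpha^\vee\in\mathcal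 L(u,w_\mu)}t_{\alpha^\vee}^{-\frac12}\,\frac{1-t^{\mathrm{ht}(-\alpha^\vee)}t_{\alpha^\vee}}{1-t^{\mathrm{ht}(-\alpha^\vee)}}\right)=t_{w_\mu}^{-\frac12}\,W_\mu(t).$$ -/

import Mathlib

noncomputable section

namespace MacdonaldPoincare

variable {ι X Y K : Type*} [Fintype ι] [AddCommGroup X] [AddCommGroup Y] [Field K]

set_option linter.unusedSectionVars false

/-! ### Finiteness of the Weyl group -/

theorem weyl_smul_sub_mem (P : RootDatum ι X Y) (w : P.weylGroup) (x : X) :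
    w • x - x ∈ P.rootSpan ℤ := by
  obtain ⟨w, hw⟩ := w
  induction hw using RootPairing.weylGroup.induction generalizing x with
  | mem i =>
    change P.reflection i x - x ∈ _
    rw [RootPairing.reflection_apply]
    have : x - P.coroot' i x • P.root i - x = -(P.coroot' i x • P.root i) := by abel
    rw [this]
    exact neg_mem (Submodule.smul_mem _ _ (Submodule.subset_span ⟨i, rfl⟩))
  | one => simp
  | mul g h hg hh ihg ihh =>
    have h1 := ihg ((⟨h, hh⟩ : P.weylGroup) • x)
    have h2 := ihh x
    have := add_mem h1 h2
    rw [sub_add_sub_cancel, ← mul_smul] at this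
    exact this

theorem weylGroupToPerm_injective (P : RootDatum ι X Y) :
    Function.Injective P.weylGroupToPerm := by
  rw [injective_iff_map_eq_one]
  intro w hw
  have key : ∀ x : X, w • x = x := by
    intro x
    have hmem := weyl_smul_sub_mem P w x
    have hker : w • x - x ∈ LinearMap.ker P.RootForm := by
      have hc : ∀ i, P.coroot' i (w • x - x) = 0 := by
        intro i
        have hi : w.1.indexEquiv.symm i = i := by
          rw [Equiv.symm_apply_eq]
          exact (DFunLike.congr_fun hw i).symm
        have h1 : P.toLinearMap (w • x) (P.coroot i)
            = P.toLinearMap x (w.1.coweightMap (P.coroot i)) :=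
          DFunLike.congr_fun
            (RootPairing.Hom.weight_coweight_transpose_apply P P (P.coroot i) w.1.toHom) x
        have h2 : w.1.coweightMap (P.coroot i) = P.coroot i := by
          have := RootPairing.Hom.coroot_coweightMap_apply P P i w.1.toHom
          rw [show w.1.toHom.indexEquiv.symm i = i from hi] at this
          exact this
        rw [h2] at h1
        rw [map_sub, sub_eq_zero]
        exact h1
      rw [LinearMap.mem_ker]
      ext y
      simp only [RootPairing.rootForm_apply_apply, hc, zero_mul, Finset.sum_const_zero,
        LinearMap.zero_apply]
    have := (Submodule.disjoint_def.mp P.disjoint_rootSpan_ker_rootForm) _ hmem hker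
    exact sub_eq_zero.mp this
  apply Subtype.ext
  apply RootPairing.Equiv.weightHom_injective P
  rw [OneMemClass.coe_one, map_one]
  ext x
  exact key x

instance finite_weylGroup (P : RootDatum ι X Y) : Finite P.weylGroup :=
  Finite.of_injective _ (weylGroupToPerm_injective P)

/-! ### Weights, stabilizers, inversion sets and lengths -/

/-- The dominant weights: `⟨μ, α_i^∨⟩ ≥ 0` for every simple coroot `α_i^∨`. -/
def IsDominant {P : RootDatum ι X Y} (b : P.Base) (μ : X) : Prop :=
  ∀ i ∈ b.support, 0 ≤ P.toLinearMap μ (P.coroot i)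

/-- The stabilizer `W_μ` of the weight `μ` in the Weyl group `W_0`, as a finite set. -/
def stab (P : RootDatum ι X Y) (μ : X) : Finset P.weylGroup :=
  (Set.toFinite {w : P.weylGroup | w • μ = μ}).toFinset

open scoped Classical in
/-- The indices of the positive roots, equivalently of the positive coroots. -/
def posIdx {P : RootDatum ι X Y} (b : P.Base) : Finset ι :=
  Finset.univ.filter fun i => b.IsPos i

open scoped Classical in
/-- The set `𝓛(w)` of positive coroots `α^∨` such that `w⁻¹ α^∨` is negative; a coroot is
represented by its index. For `w` in the finite Weyl group `W_0` these index all the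
hyperplanes that separate the fundamental alcove `A` from `wA`: since `w` fixes `d`, an affine
coroot `±α^∨ + jd` with `j ≥ 1` stays positive under `w⁻¹`. -/
def inversions {P : RootDatum ι X Y} (b : P.Base) (w : P.weylGroup) : Finset ι :=
  (posIdx b).filter fun i => ¬ b.IsPos (P.weylGroupToPerm w⁻¹ i)

open scoped Classical in
/-- The set `𝓛(v, w) = (𝓛(v) ∪ 𝓛(w)) \ (𝓛(v) ∩ 𝓛(w))` of (indices of) positive coroots whose
hyperplanes separate the alcoves `vA` and `wA`. -/
def sep {P : RootDatum ι X Y} (b : P.Base) (v w : P.weylGroup) : Finset ι :=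
  (inversions b v ∪ inversions b w) \ (inversions b v ∩ inversions b w)

/-- The length `ℓ(w) = |𝓛(w)|`. -/
def weylLength {P : RootDatum ι X Y} (b : P.Base) (w : P.weylGroup) : ℕ :=
  (inversions b w).card

/-- `w` is a longest element of the stabilizer `W_μ`. -/
def IsLongestInStab {P : RootDatum ι X Y} (b : P.Base) (μ : X) (w : P.weylGroup) : Prop :=
  w ∈ stab P μ ∧ ∀ u ∈ stab P μ, weylLength b u ≤ weylLength b w

/-! ### Parameters

Throughout `s i` is the chosen square root `t_i^{1/2}` of the parameter `t_i` attached to the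
simple root `α_i`. -/

/-- The simple reflection `s_i`. -/
def simpleRefl {P : RootDatum ι X Y} (b : P.Base) (i : b.support) : P.weylGroup :=
  RootPairing.weylGroup.ofIdx P i

/-- The product `s_{i_1} ⋯ s_{i_r}` of simple reflections along a word. -/
def wordProd {P : RootDatum ι X Y} (b : P.Base) (l : List b.support) : P.weylGroup :=
  (l.map (simpleRefl b)).prod

/-- `l` is a reduced word for `w`: a word of minimal length with product `w`. -/
def IsReducedWord {P : RootDatum ι X Y} (b : P.Base) (l : List b.support)
    (w : P.weylGroup) : Prop :=
  wordProd b l = w ∧ ∀ l', wordProd b l' = w → l.length ≤ l'.length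

open scoped Classical in
/-- `t_w^{1/2} = t_{i_1}^{1/2} ⋯ t_{i_r}^{1/2}` for a reduced expression `w = s_{i_1} ⋯ s_{i_r}`. -/
def tWeylHalf {P : RootDatum ι X Y} (b : P.Base) (s : b.support → K) (w : P.weylGroup) : K :=
  if h : ∃ l, IsReducedWord b l w then (h.choose.map s).prod else 1

open scoped Classical in
/-- `t_w = t_{i_1} ⋯ t_{i_r}` for a reduced expression `w = s_{i_1} ⋯ s_{i_r}`. -/
def tWeyl {P : RootDatum ι X Y} (b : P.Base) (s : b.support → K) (w : P.weylGroup) : K :=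
  if h : ∃ l, IsReducedWord b l w then (h.choose.map fun i => s i ^ 2).prod else 1

open scoped Classical in
/-- `t_α^{1/2} = t_{α^∨}^{1/2}`, which is `t_i^{1/2}` if `α = w α_i` with `w ∈ W_0`. The root
`α` is represented by its index. -/
def tRootHalf {P : RootDatum ι X Y} (b : P.Base) (s : b.support → K) (a : ι) : K :=
  if h : ∃ i : b.support, ∃ w : P.weylGroup, w • P.root i = P.root a then s h.choose else 1

/-- `t_α = t_{α^∨}`. -/
def tRoot {P : RootDatum ι X Y} (b : P.Base) (s : b.support → K) (a : ι) : K :=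
  tRootHalf b s a ^ 2

/-- `t^{ht(y)} = ∏_{α ∈ R_+} t_α^{½ ⟨α, y⟩}`, for `y` in the coweight lattice. -/
def tHeight {P : RootDatum ι X Y} (b : P.Base) (s : b.support → K) (y : Y) : K :=
  ∏ a ∈ posIdx b, tRootHalf b s a ^ (P.toLinearMap (P.root a) y : ℤ)

/-- The Poincaré polynomial `W_μ(t) = ∑_{u ∈ W_μ} t_u` of the stabilizer of `μ`. -/
def poincare {P : RootDatum ι X Y} (b : P.Base) (s : b.support → K) (μ : X) : K :=
  ∑ u ∈ stab P μ, tWeyl b s u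

end MacdonaldPoincare

end

namespace MacdonaldPoincare

set_option linter.unusedSectionVars false

open scoped Classical symmDiff

variable {ι X Y K : Type*} [Fintype ι] [AddCommGroup X] [AddCommGroup Y] [Field K]
  {P : RootDatum ι X Y}

/-! ### The action of the Weyl group on roots, coroots and weights -/

/-! Let `N` = `stabPos b μ` be the positive coroots orthogonal to `μ`. Since `𝓛(u) ⊆ N = 𝓛(w_μ)` for
`u ∈ W_μ`, every summand has the same denominator and the same half power of `t`
(`prod_mul_prod_sdiff_eq`). The claim thus reduces to Macdonald's identity for `W_μ`
(`sum_stab_prod_eq`), in which `y ↦ t^{ht(-y)}` may be replaced by any character `χ` of the coweight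
lattice.

Expanding the products over subsets `S ⊆ N` turns the left side into the sum of `(-1)^|S| χ(ΣS)
D(S)`, where `D(S)` is the sum over `w ∈ W_μ` of `∏ t_a` over `a ∈ S ∆ 𝓛(w)`; the right side is the
same sum with `D(∅)` in place of `D(S)`. The two agree at each exponent `σ = ΣS`
(`identityCoeff_eq_zero`). For a simple `s_j ∈ W_μ`, the involution `flipSet` extends `𝓛(w) ↦ 𝓛(s_j
w)` to all subsets of `N`. It preserves `D`, reverses the sign, and moves `σ` to `s_j σ + α_j^∨`, so
the coefficients are antisymmetric under this shifted action. Reflecting lowers `σ` until it is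
either fixed by some shifted reflection, where terms cancel in pairs, or antidominant, where only `S
= ∅` can occur and contributes `D(∅) - D(∅) = 0`. -/

theorem weylGroup_ext {v w : P.weylGroup} (h : ∀ x : X, v • x = w • x) : v = w := by
  apply Subtype.ext
  apply RootPairing.Equiv.weightHom_injective P
  ext x
  exact h x

theorem pairing_smul_coroot (w : P.weylGroup) (x : X) (a : ι) :
    P.toLinearMap (w • x) (P.coroot (P.weylGroupToPerm w a)) = P.toLinearMap x (P.coroot a) := by
  have h1 : P.toLinearMap (w • x) (P.coroot (P.weylGroupToPerm w a))
      = P.toLinearMap x (w.1.coweightMap (P.coroot (P.weylGroupToPerm w a))) :=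
    DFunLike.congr_fun (RootPairing.Hom.weight_coweight_transpose_apply P P
      (P.coroot (P.weylGroupToPerm w a)) w.1.toHom) x
  rw [h1]
  have h2 := RootPairing.Hom.coroot_coweightMap_apply P P (P.weylGroupToPerm w a) w.1.toHom
  rw [show w.1.toHom.indexEquiv.symm (P.weylGroupToPerm w a) = a from
    w.1.toHom.indexEquiv.symm_apply_apply a] at h2
  exact congrArg (P.toLinearMap x) h2

theorem pairing_coroot_perm_inv (w : P.weylGroup) (x : X) (a : ι) :
    P.toLinearMap x (P.coroot (P.weylGroupToPerm w⁻¹ a)) = P.toLinearMap (w • x) (P.coroot a) := by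
  have := pairing_smul_coroot w⁻¹ (w • x) a
  rwa [inv_smul_smul] at this

theorem ofIdx_smul_eq (a : ι) (x : X) :
    RootPairing.weylGroup.ofIdx P a • x = x - P.toLinearMap x (P.coroot a) • P.root a := by
  change P.reflection a x = _
  rw [RootPairing.reflection_apply]
  rfl

theorem perm_ofIdx (a c : ι) :
    P.weylGroupToPerm (RootPairing.weylGroup.ofIdx P a) c = P.reflectionPerm a c := rfl

theorem ofIdx_inv (a : ι) :
    (RootPairing.weylGroup.ofIdx P a)⁻¹ = RootPairing.weylGroup.ofIdx P a :=
  Subtype.ext (RootPairing.Equiv.reflection_inv P a)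

theorem ofIdx_perm (w : P.weylGroup) (a : ι) :
    RootPairing.weylGroup.ofIdx P (P.weylGroupToPerm w a) =
      w * RootPairing.weylGroup.ofIdx P a * w⁻¹ := by
  apply weylGroup_ext
  intro x
  rw [mul_smul, mul_smul, ofIdx_smul_eq, ofIdx_smul_eq, smul_sub, smul_inv_smul,
    smul_comm w, RootPairing.weylGroup_apply_root, ← pairing_smul_coroot w (w⁻¹ • x),
    smul_inv_smul]

theorem simpleRefl_inv (b : P.Base) (j : b.support) : (simpleRefl b j)⁻¹ = simpleRefl b j :=
  ofIdx_inv _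

theorem simpleRefl_mul_self (b : P.Base) (j : b.support) :
    simpleRefl b j * simpleRefl b j = 1 := by
  rw [mul_eq_one_iff_inv_eq, simpleRefl_inv]

theorem isPos_reflectionPerm_self (b : P.Base) (a : ι) :
    b.IsPos (P.reflectionPerm a a) ↔ ¬ b.IsPos a :=
  RootPairing.Base.IsPos.neg_iff_not b a

theorem mem_posIdx {b : P.Base} {a : ι} : a ∈ posIdx b ↔ b.IsPos a := by
  simp [posIdx]

theorem mem_inversions {b : P.Base} {w : P.weylGroup} {a : ι} :
    a ∈ inversions b w ↔ b.IsPos a ∧ ¬ b.IsPos (P.weylGroupToPerm w⁻¹ a) := by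
  simp [inversions, mem_posIdx]

theorem mem_stab {μ : X} {w : P.weylGroup} : w ∈ stab P μ ↔ w • μ = μ := by
  simp [stab]

/-! ### The permutation of the positive roots by a simple reflection -/

/-- The reflection in `a`, modified so as to fix `a` and its negative. -/
noncomputable def posPerm (P : RootDatum ι X Y) (a : ι) : Equiv.Perm ι :=
  P.reflectionPerm a * Equiv.swap a (P.reflectionPerm a a)

theorem posPerm_self (a : ι) : posPerm P a a = a := by
  simp [posPerm]

theorem posPerm_neg (a : ι) : posPerm P a (P.reflectionPerm a a) = P.reflectionPerm a a := by
  simp [posPerm]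

theorem posPerm_of_ne {a c : ι} (h : c ≠ a) (h' : c ≠ P.reflectionPerm a a) :
    posPerm P a c = P.reflectionPerm a c := by
  simp [posPerm, Equiv.swap_apply_of_ne_of_ne h h']

theorem posPerm_posPerm (a c : ι) : posPerm P a (posPerm P a c) = c := by
  by_cases h : c = a
  · subst h; simp only [posPerm_self]
  by_cases h' : c = P.reflectionPerm a a
  · subst h'; simp only [posPerm_neg]
  rw [posPerm_of_ne h h', posPerm_of_ne _ _]
  · simp
  · rintro h1
    exact h' (by simpa using congrArg (P.reflectionPerm a) h1)
  · intro h1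
    exact h ((P.reflectionPerm a).injective h1)

/-- Reducedness matters here: a positive root `2α_j` would be sent to a negative one. -/
theorem isPos_posPerm [P.IsReduced] {b : P.Base} {j : ι} (hj : j ∈ b.support) {c : ι}
    (hc : b.IsPos c) : b.IsPos (posPerm P j c) := by
  by_cases h : c = j
  · subst h; rwa [posPerm_self]
  by_cases h' : c = P.reflectionPerm j j
  · subst h'; rwa [posPerm_neg]
  rw [posPerm_of_ne h h']
  exact hc.reflectionPerm hj h

theorem posPerm_of_isPos {b : P.Base} {j : ι} (hj : j ∈ b.support) {c : ι}
    (hc : b.IsPos c) (h : c ≠ j) : posPerm P j c = P.reflectionPerm j c := by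
  apply posPerm_of_ne h
  rintro rfl
  exact (isPos_reflectionPerm_self b j).mp hc (b.isPos_of_mem_support hj)

/-- The action of a simple reflection on sets of positive roots under which the inversion set of
`w` goes to that of `s_j w`. -/
noncomputable def flipSet (P : RootDatum ι X Y) (j : ι) (S : Finset ι) : Finset ι :=
  S.image (posPerm P j) ∆ {j}

theorem mem_image_posPerm {j a : ι} {S : Finset ι} :
    a ∈ S.image (posPerm P j) ↔ posPerm P j a ∈ S := by
  rw [Finset.mem_image]
  constructor
  · rintro ⟨c, hc, rfl⟩
    rwa [posPerm_posPerm]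
  · intro h
    exact ⟨_, h, posPerm_posPerm _ _⟩

theorem mem_flipSet {j a : ι} {S : Finset ι} :
    a ∈ flipSet P j S ↔ (posPerm P j a ∈ S ∧ a ≠ j) ∨ (a = j ∧ posPerm P j a ∉ S) := by
  rw [flipSet, Finset.mem_symmDiff, mem_image_posPerm, Finset.mem_singleton]

theorem self_mem_flipSet {j : ι} {S : Finset ι} : j ∈ flipSet P j S ↔ j ∉ S := by
  simp [mem_flipSet, posPerm_self]

theorem flipSet_flipSet (j : ι) (S : Finset ι) : flipSet P j (flipSet P j S) = S := by
  ext a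
  by_cases h : a = j
  · subst h
    simp [self_mem_flipSet]
  · have h' : posPerm P j a ≠ j := fun h1 ↦ h (by
      rw [← posPerm_posPerm (P := P) j a, h1, posPerm_self])
    simp [mem_flipSet, h, h', posPerm_posPerm]

/-- The two copies of `{j}` cancel. Flipping both sets therefore only relabels their difference,
which is what makes `distPoly` invariant. -/
theorem flipSet_symmDiff_flipSet (j : ι) (S T : Finset ι) :
    flipSet P j S ∆ flipSet P j T = (S ∆ T).image (posPerm P j) := by
  rw [flipSet, flipSet, Finset.image_symmDiff _ _ (posPerm P j).injective,
    symmDiff_symmDiff_symmDiff_comm, symmDiff_self, symmDiff_bot]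

theorem flipSet_of_mem {j : ι} {S : Finset ι} (h : j ∈ S) :
    flipSet P j S = (S.erase j).image (posPerm P j) := by
  ext a
  rw [mem_image_posPerm, Finset.mem_erase, mem_flipSet]
  by_cases ha : a = j
  · subst ha; simp [posPerm_self, h]
  · have h' : posPerm P j a ≠ j := fun h1 ↦ ha (by
      rw [← posPerm_posPerm (P := P) j a, h1, posPerm_self])
    simp [ha, h']

theorem flipSet_of_notMem {j : ι} {S : Finset ι} (h : j ∉ S) :
    flipSet P j S = insert j (S.image (posPerm P j)) := by
  ext a
  rw [Finset.mem_insert, mem_image_posPerm, mem_flipSet]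
  by_cases ha : a = j
  · subst ha; simp [posPerm_self, h]
  · simp [ha]

theorem inversions_simpleRefl_mul [P.IsReduced] (b : P.Base) (j : b.support) (w : P.weylGroup) :
    inversions b (simpleRefl b j * w) = flipSet P j (inversions b w) := by
  have hw (a : ι) : P.weylGroupToPerm (simpleRefl b j * w)⁻¹ a =
      P.weylGroupToPerm w⁻¹ (P.reflectionPerm j a) := by
    rw [mul_inv_rev, simpleRefl_inv, map_mul]
    rfl
  -- At `a = j` the reflection negates the root, so membership of `j` is toggled.
  have hneg : P.weylGroupToPerm w⁻¹ (P.reflectionPerm j j) =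
      P.reflectionPerm (P.weylGroupToPerm w⁻¹ j) (P.weylGroupToPerm w⁻¹ j) := by
    apply P.root.injective
    rw [← RootPairing.weylGroup_apply_root, RootPairing.root_reflectionPerm,
      RootPairing.root_reflectionPerm, RootPairing.reflection_apply_self,
      RootPairing.reflection_apply_self, smul_neg, RootPairing.weylGroup_apply_root]
  have hjpos := b.isPos_of_mem_support j.2
  ext a
  rw [mem_inversions, hw]
  by_cases ha : a = j
  · subst ha
    rw [self_mem_flipSet, hneg, isPos_reflectionPerm_self, mem_inversions]
    tauto
  · rw [mem_flipSet, mem_inversions]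
    by_cases hpos : b.IsPos a
    · rw [posPerm_of_isPos j.2 hpos ha]
      have := hpos.reflectionPerm j.2 ha
      simp [ha, hpos, this]
    · have : ¬ b.IsPos (posPerm P j a) := fun h ↦ hpos (by
        simpa [posPerm_posPerm] using isPos_posPerm j.2 h)
      simp [ha, hpos, this]

theorem inversions_one (b : P.Base) : inversions b 1 = ∅ := by
  ext a
  simp [mem_inversions]

theorem prod_inversions_simpleRefl_mul [P.IsReduced] {b : P.Base} {t : ι → K}
    (ht : ∀ (w : P.weylGroup) a, t (P.weylGroupToPerm w a) = t a) (j : b.support)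
    (w : P.weylGroup) (hj : (j : ι) ∉ inversions b w) :
    ∏ a ∈ inversions b (simpleRefl b j * w), t a = t j * ∏ a ∈ inversions b w, t a := by
  have hq (c : ι) (hc : c ∈ inversions b w) : t (posPerm P j c) = t c := by
    have hne : c ≠ j := fun h ↦ hj (h ▸ hc)
    rw [posPerm_of_isPos j.2 (mem_inversions.mp hc).1 hne, ← perm_ofIdx, ht]
  rw [inversions_simpleRefl_mul, flipSet_of_notMem hj, Finset.prod_insert,
    Finset.prod_image (posPerm P j).injective.injOn, Finset.prod_congr rfl hq]
  rwa [mem_image_posPerm, posPerm_self]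

/-! ### Words in the simple reflections -/

theorem wordProd_cons (b : P.Base) (j : b.support) (l : List b.support) :
    wordProd b (j :: l) = simpleRefl b j * wordProd b l := by
  simp [wordProd]

theorem exists_wordProd [P.IsReduced] (b : P.Base) (w : P.weylGroup) : ∃ l, wordProd b l = w := by
  have happ (l l' : List b.support) : wordProd b (l ++ l') = wordProd b l * wordProd b l' := by
    simp [wordProd]
  have hrefl (a : ι) : ∃ l, wordProd b l = RootPairing.weylGroup.ofIdx P a := by
    induction a using b.induction_reflect with
    | h₀ a ih =>
      obtain ⟨l, hl⟩ := ih
      refine ⟨l, ?_⟩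
      rw [hl, ← perm_ofIdx, ofIdx_perm]
      group
    | h₁ a ha => exact ⟨[⟨a, ha⟩], by simp [wordProd, simpleRefl]⟩
    | h₂ a j ih hj =>
      obtain ⟨l, hl⟩ := ih
      refine ⟨[⟨j, hj⟩] ++ l ++ [⟨j, hj⟩], ?_⟩
      rw [happ, happ, hl, ← perm_ofIdx, ofIdx_perm, ofIdx_inv]
      simp [wordProd, simpleRefl]
  obtain ⟨w, hw⟩ := w
  induction hw using RootPairing.weylGroup.induction with
  | mem a => exact hrefl a
  | one => exact ⟨[], rfl⟩
  | mul g h hg hh ihg ihh =>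
    obtain ⟨l, hl⟩ := ihg
    obtain ⟨l', hl'⟩ := ihh
    exact ⟨l ++ l', by rw [happ, hl, hl']; rfl⟩

theorem exists_isReducedWord [P.IsReduced] (b : P.Base) (w : P.weylGroup) : ∃ l, IsReducedWord b l w := by
  have h : ∃ n, ∃ l, wordProd b l = w ∧ l.length = n := by
    obtain ⟨l, hl⟩ := exists_wordProd b w
    exact ⟨_, l, hl, rfl⟩
  obtain ⟨l, hl, hlen⟩ := Nat.find_spec h
  exact ⟨l, hl, fun l' hl' ↦ hlen ▸ Nat.find_min' h ⟨l', hl', rfl⟩⟩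

/-- The exchange condition. -/
theorem exists_wordProd_eq_ofIdx_mul [P.IsReduced] (b : P.Base) (l : List b.support) (a : ι)
    (ha : a ∈ inversions b (wordProd b l)) :
    ∃ l' : List b.support, l'.length + 1 = l.length ∧
      wordProd b l' = RootPairing.weylGroup.ofIdx P a * wordProd b l := by
  induction l generalizing a with
  | nil => simp [wordProd, inversions_one] at ha
  | cons j l ih =>
    rw [wordProd_cons] at ha ⊢
    by_cases haj : a = j
    · subst haj
      refine ⟨l, rfl, ?_⟩
      rw [← mul_assoc]
      exact (by rw [show RootPairing.weylGroup.ofIdx P (j : ι) = simpleRefl b j from rfl,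
        simpleRefl_mul_self, one_mul])
    · have hpos := (mem_inversions.mp ha).1
      rw [inversions_simpleRefl_mul, mem_flipSet, posPerm_of_isPos j.2 hpos haj] at ha
      obtain ⟨l', hlen, hl'⟩ := ih (P.reflectionPerm j a) (by tauto)
      refine ⟨j :: l', by simpa using hlen, ?_⟩
      rw [wordProd_cons, hl', ← perm_ofIdx, ofIdx_perm, ofIdx_inv]
      change simpleRefl b j * (simpleRefl b j * _ * simpleRefl b j * _) = _
      rw [← mul_assoc, ← mul_assoc, ← mul_assoc, simpleRefl_mul_self, one_mul, mul_assoc]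

theorem IsReducedWord.prod_eq [P.IsReduced] {b : P.Base} {t : ι → K}
    (ht : ∀ (w : P.weylGroup) a, t (P.weylGroupToPerm w a) = t a) {l : List b.support}
    {w : P.weylGroup} (hl : IsReducedWord b l w) :
    (l.map fun j : b.support ↦ t (j : ι)).prod = ∏ a ∈ inversions b w, t a := by
  induction l generalizing w with
  | nil =>
    obtain rfl : 1 = w := hl.1
    simp [inversions_one]
  | cons j l ih =>
    obtain ⟨hw, hmin⟩ := hl
    rw [wordProd_cons] at hw
    subst hw
    have hj : (j : ι) ∉ inversions b (wordProd b l) := by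
      intro h
      -- Exchange would give the whole product a word two letters shorter than `j :: l`.
      obtain ⟨l', hlen, hl'⟩ := exists_wordProd_eq_ofIdx_mul b l j h
      have := hmin l' hl'
      simp at this
      omega
    rw [prod_inversions_simpleRefl_mul ht j _ hj, List.map_cons, List.prod_cons, ih ⟨rfl, ?_⟩]
    intro l' hl'
    have := hmin (j :: l') (by rw [wordProd_cons, hl'])
    simpa using this

/-! ### The parameters -/

/-- Roots in one Weyl orbit have conjugate reflections, so `hs` makes the chosen simple root
immaterial. -/
theorem tRootHalf_eq {b : P.Base} {s : b.support → K}
    (hs : ∀ i j, IsConj (simpleRefl b i) (simpleRefl b j) → s i = s j)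
    {a : ι} {i : b.support} {w : P.weylGroup} (h : P.weylGroupToPerm w i = a) :
    tRootHalf b s a = s i := by
  have hex : ∃ i : b.support, ∃ w : P.weylGroup, w • P.root i = P.root a :=
    ⟨i, w, by rw [RootPairing.weylGroup_apply_root, h]⟩
  rw [tRootHalf, dif_pos hex]
  obtain ⟨v, hv⟩ := hex.choose_spec
  rw [RootPairing.weylGroup_apply_root] at hv
  have hv' : P.weylGroupToPerm v hex.choose = a := P.root.injective hv
  apply hs
  rw [isConj_iff]
  refine ⟨w⁻¹ * v, ?_⟩
  have h1 := ofIdx_perm v (hex.choose : ι)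
  have h2 := ofIdx_perm w (i : ι)
  rw [hv'] at h1
  rw [h, h1] at h2
  change w⁻¹ * v * RootPairing.weylGroup.ofIdx P _ * _ = RootPairing.weylGroup.ofIdx P i
  calc _ = w⁻¹ * (v * RootPairing.weylGroup.ofIdx P hex.choose * v⁻¹) * w := by group
    _ = _ := by rw [h2]; group

theorem exists_perm_simple [P.IsReduced] (b : P.Base) (a : ι) :
    ∃ (i : b.support) (w : P.weylGroup), P.weylGroupToPerm w i = a := by
  induction a using b.induction_reflect with
  | h₀ a ih =>
    obtain ⟨i, w, rfl⟩ := ih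
    exact ⟨i, RootPairing.weylGroup.ofIdx P _ * w, by rw [map_mul]; rfl⟩
  | h₁ a ha => exact ⟨⟨a, ha⟩, 1, by simp⟩
  | h₂ a j ih hj =>
    obtain ⟨i, w, rfl⟩ := ih
    exact ⟨i, RootPairing.weylGroup.ofIdx P j * w, by rw [map_mul]; rfl⟩

section Parameters

variable {b : P.Base} {s : b.support → K}

theorem tRootHalf_simple (i : b.support) (hs : ∀ i j,
    IsConj (simpleRefl b i) (simpleRefl b j) → s i = s j) : tRootHalf b s i = s i :=
  tRootHalf_eq hs (w := 1) (by simp)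

theorem tRootHalf_perm [P.IsReduced] (hs : ∀ i j, IsConj (simpleRefl b i) (simpleRefl b j) → s i = s j)
    (w : P.weylGroup) (a : ι) :
    tRootHalf b s (P.weylGroupToPerm w a) = tRootHalf b s a := by
  obtain ⟨i, v, rfl⟩ := exists_perm_simple b a
  rw [tRootHalf_eq hs (w := v) rfl, tRootHalf_eq hs (w := w * v) (by rw [map_mul]; rfl)]

theorem tRootHalf_ne_zero [P.IsReduced] (hs : ∀ i j, IsConj (simpleRefl b i) (simpleRefl b j) → s i = s j)
    (hs0 : ∀ i, s i ≠ 0) (a : ι) : tRootHalf b s a ≠ 0 := by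
  obtain ⟨i, v, rfl⟩ := exists_perm_simple b a
  rw [tRootHalf_eq hs (w := v) rfl]
  exact hs0 i

theorem tWeylHalf_eq_prod [P.IsReduced]
    (hs : ∀ i j, IsConj (simpleRefl b i) (simpleRefl b j) → s i = s j) (w : P.weylGroup) :
    tWeylHalf b s w = ∏ a ∈ inversions b w, tRootHalf b s a := by
  have h := exists_isReducedWord b w
  rw [tWeylHalf, dif_pos h, ← h.choose_spec.prod_eq (tRootHalf_perm hs)]
  simp only [tRootHalf_simple _ hs]

theorem tWeyl_eq_prod [P.IsReduced]
    (hs : ∀ i j, IsConj (simpleRefl b i) (simpleRefl b j) → s i = s j) (w : P.weylGroup) :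
    tWeyl b s w = ∏ a ∈ inversions b w, tRoot b s a := by
  have h := exists_isReducedWord b w
  rw [tWeyl, dif_pos h, ← h.choose_spec.prod_eq (t := tRoot b s)
    (fun w a ↦ by rw [tRoot, tRoot, tRootHalf_perm hs])]
  simp only [tRoot, tRootHalf_simple _ hs]

theorem tHeight_add (h0 : ∀ a, tRootHalf b s a ≠ 0) (y z : Y) :
    tHeight b s (y + z) = tHeight b s y * tHeight b s z := by
  simp only [tHeight, map_add, zpow_add₀ (h0 _), Finset.prod_mul_distrib]

theorem tHeight_zero : tHeight b s 0 = 1 := by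
  simp [tHeight]

end Parameters

/-! ### Positivity of coroots -/

theorem rootForm_root_self_pos (P : RootDatum ι X Y) (a : ι) :
    0 < P.RootForm (P.root a) (P.root a) := by
  rw [RootPairing.rootForm_apply_apply]
  refine Finset.sum_pos' (fun _ _ ↦ mul_self_nonneg _) ⟨a, Finset.mem_univ _, ?_⟩
  simp

/-- Positivity in `b` is defined through roots. Since `a^∨` is `2a / (a, a)` under the invariant
form, multiplying by `(a, a)` carries the expansion in simple roots to one in simple coroots with
integer coefficients. -/
theorem exists_smul_coroot_eq_sum {b : P.Base} {a : ι} (ha : b.IsPos a) :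
    ∃ (d : ℤ) (m : ι → ℤ), 0 < d ∧ (∀ j, 0 ≤ m j) ∧
      d • P.coroot a = ∑ j ∈ b.support, m j • P.coroot j := by
  obtain ⟨f, -, hf, hsum⟩ := b.exists_root_eq_sum_int a
  have hf0 : ∀ j, 0 ≤ f j := by
    rcases hf with h | h
    · exact h.le
    · exfalso
      have h1 : 0 < ∑ j ∈ b.support, f j := b.height_eq_sum hsum ▸ ha
      exact absurd h1 (not_lt.mpr (Finset.sum_nonpos fun j _ ↦ h.le j))
  refine ⟨P.RootForm (P.root a) (P.root a),
    fun j ↦ f j * P.RootForm (P.root j) (P.root j), rootForm_root_self_pos P a,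
    fun j ↦ mul_nonneg (hf0 j) (rootForm_root_self_pos P j).le, ?_⟩
  rw [RootPairing.rootForm_self_smul_coroot]
  conv_lhs => rw [hsum]
  rw [map_sum, Finset.smul_sum]
  refine Finset.sum_congr rfl fun j _ ↦ ?_
  rw [mul_smul, RootPairing.rootForm_self_smul_coroot, map_zsmul, smul_comm]

/-- Twice the half sum of the positive roots. -/
noncomputable def twoRho (b : P.Base) : X := ∑ a ∈ posIdx b, P.root a

/-- The reflection `s_j` permutes the positive roots other than `α_j` and negates their pairings
with `α_j^∨`, so these sum to zero and only `α_j` contributes. -/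
theorem twoRho_simple [P.IsReduced] (b : P.Base) (j : b.support) :
    P.toLinearMap (twoRho b) (P.coroot j) = 2 := by
  have hj := mem_posIdx.mpr (b.isPos_of_mem_support j.2)
  rw [twoRho, map_sum, LinearMap.sum_apply, ← Finset.add_sum_erase _ _ hj]
  have h2 : P.toLinearMap (P.root j) (P.coroot j) = 2 := P.pairing_same j
  have hzero : ∑ a ∈ (posIdx b).erase j, P.toLinearMap (P.root a) (P.coroot j) = 0 := by
    have key : ∑ a ∈ (posIdx b).erase j, P.toLinearMap (P.root a) (P.coroot j) =
        ∑ a ∈ (posIdx b).erase j, -P.toLinearMap (P.root a) (P.coroot j) := by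
      have hmem : ∀ a ∈ (posIdx b).erase (j : ι), P.reflectionPerm j a ∈ (posIdx b).erase (j : ι) := by
        intro a ha
        obtain ⟨hne, hpos⟩ := Finset.mem_erase.mp ha
        rw [mem_posIdx] at hpos
        refine Finset.mem_erase.mpr ⟨fun h ↦ ?_, mem_posIdx.mpr (hpos.reflectionPerm j.2 hne)⟩
        have h' : a = P.reflectionPerm j j := by
          simpa using congrArg (P.reflectionPerm j) h
        rw [h'] at hpos
        exact (isPos_reflectionPerm_self b j).mp hpos (b.isPos_of_mem_support j.2)
      refine Finset.sum_nbij' (P.reflectionPerm j) (P.reflectionPerm j) hmem hmem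
        (by simp) (by simp) fun a _ ↦ ?_
      rw [RootPairing.root_reflectionPerm, RootPairing.reflection_apply, map_sub, map_zsmul,
        LinearMap.sub_apply, LinearMap.smul_apply, h2]
      change _ = -(_ - P.toLinearMap (P.root a) (P.coroot j) • 2)
      rw [smul_eq_mul]
      ring
    rw [Finset.sum_neg_distrib] at key
    omega
  rw [hzero, h2, add_zero]

theorem twoRho_pos [P.IsReduced] {b : P.Base} {a : ι} (ha : b.IsPos a) :
    0 < P.toLinearMap (twoRho b) (P.coroot a) := by
  obtain ⟨d, m, hd, hm, h⟩ := exists_smul_coroot_eq_sum ha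
  have h1 : d * P.toLinearMap (twoRho b) (P.coroot a) = ∑ j ∈ b.support, m j * 2 := by
    rw [← smul_eq_mul, ← map_zsmul, h, map_sum]
    refine Finset.sum_congr rfl fun j hj ↦ ?_
    rw [map_zsmul, smul_eq_mul, twoRho_simple b ⟨j, hj⟩]
  have h2 : 0 < ∑ j ∈ b.support, m j * 2 := by
    refine Finset.sum_pos' (fun j _ ↦ by have := hm j; omega) ?_
    by_contra! hcon
    have : d • P.coroot a = 0 := by
      rw [h]
      refine Finset.sum_eq_zero fun j hj ↦ ?_
      have h3 : m j = 0 := by have := hm j; have := hcon j hj; omega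
      rw [h3, zero_smul]
    have h3 := congrArg (P.toLinearMap (P.root a)) this
    rw [map_zsmul, map_zero, show P.toLinearMap (P.root a) (P.coroot a) = 2 from P.pairing_same a,
      smul_eq_mul] at h3
    omega
  rw [← h1] at h2
  exact pos_of_mul_pos_right h2 hd.le

/-- This makes positivity the sign of a linear functional on coroots, which can be tested on sums of
simple coroots. -/
theorem isPos_iff_twoRho_pos [P.IsReduced] {b : P.Base} {a : ι} :
    b.IsPos a ↔ 0 < P.toLinearMap (twoRho b) (P.coroot a) := by
  refine ⟨twoRho_pos, fun h ↦ ?_⟩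
  by_contra hneg
  rw [← isPos_reflectionPerm_self] at hneg
  have := twoRho_pos hneg
  rw [RootPairing.coroot_reflectionPerm, RootPairing.coreflection_apply_self, map_neg] at this
  omega

theorem IsDominant.pairing_nonneg {b : P.Base} {μ : X} (hμ : IsDominant b μ) {a : ι}
    (ha : b.IsPos a) : 0 ≤ P.toLinearMap μ (P.coroot a) := by
  obtain ⟨d, m, hd, hm, h⟩ := exists_smul_coroot_eq_sum ha
  have h1 : 0 ≤ d * P.toLinearMap μ (P.coroot a) := by
    rw [← smul_eq_mul, ← map_zsmul, h, map_sum]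
    refine Finset.sum_nonneg fun j hj ↦ ?_
    rw [map_zsmul, smul_eq_mul]
    exact mul_nonneg (hm j) (hμ j hj)
  exact nonneg_of_mul_nonneg_right h1 hd

/-! ### The parabolic subsystem of a dominant weight -/

/-- The positive roots of the stabilizer of `μ`. -/
noncomputable def stabPos (b : P.Base) (μ : X) : Finset ι :=
  (posIdx b).filter fun a ↦ P.toLinearMap μ (P.coroot a) = 0

theorem mem_stabPos {b : P.Base} {μ : X} {a : ι} :
    a ∈ stabPos b μ ↔ b.IsPos a ∧ P.toLinearMap μ (P.coroot a) = 0 := by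
  simp [stabPos, mem_posIdx]

theorem exists_smul_coroot_eq_sum_stab {b : P.Base} {μ : X} (hμ : IsDominant b μ) {a : ι}
    (ha : a ∈ stabPos b μ) :
    ∃ (d : ℤ) (m : ι → ℤ), 0 < d ∧ (∀ j, 0 ≤ m j) ∧
      (∀ j ∈ b.support, m j ≠ 0 → P.toLinearMap μ (P.coroot j) = 0) ∧
      d • P.coroot a = ∑ j ∈ b.support, m j • P.coroot j := by
  obtain ⟨hpos, h0⟩ := mem_stabPos.mp ha
  obtain ⟨d, m, hd, hm, h⟩ := exists_smul_coroot_eq_sum hpos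
  refine ⟨d, m, hd, hm, fun j hj hmj ↦ ?_, h⟩
  have h1 : ∑ j ∈ b.support, m j * P.toLinearMap μ (P.coroot j) = 0 := by
    have := congrArg (P.toLinearMap μ) h
    rw [map_zsmul, h0, smul_zero, map_sum] at this
    rw [this]
    exact Finset.sum_congr rfl fun j _ ↦ by rw [map_zsmul, smul_eq_mul]
  -- Nonnegative terms with sum zero all vanish, so only simple coroots orthogonal to `μ` occur.
  rw [Finset.sum_eq_zero_iff_of_nonneg fun j hj ↦ mul_nonneg (hm j) (hμ j hj)] at h1
  exact (mul_eq_zero.mp (h1 j hj)).resolve_left hmj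

/-- If `u⁻¹` makes `a^∨` negative, dominance gives `⟨μ, u⁻¹ a^∨⟩ ≤ 0`. This pairing is `⟨uμ, a^∨⟩ =
⟨μ, a^∨⟩`, which is also nonnegative. -/
theorem inversions_subset_stabPos {b : P.Base} {μ : X} (hμ : IsDominant b μ)
    {u : P.weylGroup} (hu : u ∈ stab P μ) : inversions b u ⊆ stabPos b μ := by
  intro a ha
  obtain ⟨hpos, hneg⟩ := mem_inversions.mp ha
  refine mem_stabPos.mpr ⟨hpos, le_antisymm ?_ (hμ.pairing_nonneg hpos)⟩
  rw [← isPos_reflectionPerm_self] at hneg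
  have h := hμ.pairing_nonneg hneg
  rw [RootPairing.coroot_reflectionPerm, RootPairing.coreflection_apply_self, map_neg,
    pairing_coroot_perm_inv, mem_stab.mp hu] at h
  omega

theorem simpleRefl_mem_stab {b : P.Base} {μ : X} {j : b.support}
    (hj : P.toLinearMap μ (P.coroot j) = 0) : simpleRefl b j ∈ stab P μ := by
  rw [mem_stab, simpleRefl, ofIdx_smul_eq, hj, zero_smul, sub_zero]

theorem simpleRefl_mul_mem_stab {b : P.Base} {μ : X} {j : b.support}
    (hj : P.toLinearMap μ (P.coroot j) = 0) {u : P.weylGroup} (hu : u ∈ stab P μ) :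
    simpleRefl b j * u ∈ stab P μ := by
  rw [mem_stab, mul_smul, mem_stab.mp hu, mem_stab.mp (simpleRefl_mem_stab hj)]

/-- By maximality of the length, `w` inverts every simple coroot orthogonal to `μ`. So `w • 2ρ` is
nonpositive on these, and hence on all of `stabPos b μ`. -/
theorem IsLongestInStab.inversions_eq [P.IsReduced] {b : P.Base} {μ : X} (hμ : IsDominant b μ)
    {w : P.weylGroup} (hw : IsLongestInStab b μ w) : inversions b w = stabPos b μ := by
  refine (inversions_subset_stabPos hμ hw.1).antisymm fun a ha ↦ ?_
  have hsimple : ∀ j ∈ b.support, P.toLinearMap μ (P.coroot j) = 0 → j ∈ inversions b w := by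
    intro j hj hj0
    by_contra hnot
    have hlen := hw.2 _ (simpleRefl_mul_mem_stab (j := ⟨j, hj⟩) hj0 hw.1)
    rw [weylLength, weylLength, inversions_simpleRefl_mul, flipSet_of_notMem hnot,
      Finset.card_insert_of_notMem (by rwa [mem_image_posPerm, posPerm_self]),
      Finset.card_image_of_injective _ (posPerm P j).injective] at hlen
    omega
  obtain ⟨d, m, hd, hm, hm0, h⟩ := exists_smul_coroot_eq_sum_stab hμ ha
  refine mem_inversions.mpr ⟨(mem_stabPos.mp ha).1, ?_⟩
  rw [isPos_iff_twoRho_pos, pairing_coroot_perm_inv, not_lt]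
  have h1 : d * P.toLinearMap (w • twoRho b) (P.coroot a) ≤ 0 := by
    rw [← smul_eq_mul, ← map_zsmul, h, map_sum]
    refine Finset.sum_nonpos fun j hj ↦ ?_
    rw [map_zsmul, smul_eq_mul]
    by_cases hmj : m j = 0
    · simp [hmj]
    · have h2 := (mem_inversions.mp (hsimple j hj (hm0 j hj hmj))).2
      rw [isPos_iff_twoRho_pos, pairing_coroot_perm_inv, not_lt] at h2
      exact mul_nonpos_of_nonneg_of_nonpos (hm j) h2
  exact nonpos_of_mul_nonpos_right h1 hd

theorem flipSet_subset_stabPos [P.IsReduced] {b : P.Base} {μ : X} {j : b.support}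
    (hj : P.toLinearMap μ (P.coroot j) = 0) {S : Finset ι} (hS : S ⊆ stabPos b μ) :
    flipSet P j S ⊆ stabPos b μ := by
  intro a ha
  by_cases haj : a = j
  · subst haj
    exact mem_stabPos.mpr ⟨b.isPos_of_mem_support j.2, hj⟩
  · have hmem : posPerm P j a ∈ stabPos b μ := hS (by rw [mem_flipSet] at ha; tauto)
    obtain ⟨hpos, h0⟩ := mem_stabPos.mp hmem
    have hapos : b.IsPos a := by simpa [posPerm_posPerm] using isPos_posPerm j.2 hpos
    refine mem_stabPos.mpr ⟨hapos, ?_⟩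
    rw [posPerm_of_isPos j.2 hapos haj, ← perm_ofIdx, ← ofIdx_inv, pairing_coroot_perm_inv] at h0
    rwa [← mem_stab.mp (simpleRefl_mem_stab hj)]

/-- This is the action of `s_j` centred at the half sum of the positive coroots; its fixed
hyperplane is `⟨α_j, σ⟩ = 1`. -/
theorem sum_coroot_flipSet {b : P.Base} {j : b.support} {S : Finset ι}
    (hS : ∀ a ∈ S, b.IsPos a) :
    ∑ a ∈ flipSet P j S, P.coroot a = P.coreflection j (∑ a ∈ S, P.coroot a) + P.coroot j := by
  have hq : ∀ a ∈ S.erase (j : ι), P.coroot (posPerm P j a) = P.coreflection j (P.coroot a) := by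
    intro a ha
    obtain ⟨hne, hmem⟩ := Finset.mem_erase.mp ha
    rw [posPerm_of_isPos j.2 (hS a hmem) hne, RootPairing.coroot_reflectionPerm]
  by_cases hj : (j : ι) ∈ S
  · rw [flipSet_of_mem hj, Finset.sum_image (posPerm P j).injective.injOn, Finset.sum_congr rfl hq,
      ← Finset.add_sum_erase _ _ hj, map_add, RootPairing.coreflection_apply_self, map_sum]
    abel
  · rw [Finset.erase_eq_of_notMem hj] at hq
    rw [flipSet_of_notMem hj, Finset.sum_insert, Finset.sum_image (posPerm P j).injective.injOn,
      Finset.sum_congr rfl hq, map_sum, add_comm]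
    rwa [mem_image_posPerm, posPerm_self]

theorem neg_one_pow_card_flipSet (j : ι) (S : Finset ι) :
    (-1 : K) ^ (flipSet P j S).card = -(-1) ^ S.card := by
  by_cases hj : j ∈ S
  · rw [flipSet_of_mem hj, Finset.card_image_of_injective _ (posPerm P j).injective,
      ← Finset.card_erase_add_one hj, pow_succ]
    simp
  · rw [flipSet_of_notMem hj, Finset.card_insert_of_notMem (by rwa [mem_image_posPerm, posPerm_self]),
      Finset.card_image_of_injective _ (posPerm P j).injective, pow_succ]
    simp

/-! ### Macdonald's identity for the stabilizer -/

/-- The sum over `w` in the stabilizer of `μ` of the parameters of the hyperplanes separating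
`w` from the set `S` of positive roots. -/
noncomputable def distPoly (b : P.Base) (μ : X) (t : ι → K) (S : Finset ι) : K :=
  ∑ w ∈ stab P μ, ∏ a ∈ S ∆ inversions b w, t a

/-- The coefficient at `σ` of the difference of the two sides of Macdonald's identity. -/
noncomputable def identityCoeff (b : P.Base) (μ : X) (t : ι → K) (σ : Y) : K :=
  ∑ S ∈ (stabPos b μ).powerset with ∑ a ∈ S, P.coroot a = σ,
    (-1) ^ S.card * (distPoly b μ t S - distPoly b μ t ∅)

section Identity

variable [P.IsReduced] {b : P.Base} {μ : X} {t : ι → K}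

/-- Substitute `s_j w` for `w`: the symmetric difference is moved by `posPerm`, and `t` is constant
on orbits. -/
theorem distPoly_flipSet (ht : ∀ (w : P.weylGroup) a, t (P.weylGroupToPerm w a) = t a)
    (hμ : IsDominant b μ) {j : b.support} (hj : P.toLinearMap μ (P.coroot j) = 0)
    {S : Finset ι} (hS : S ⊆ stabPos b μ) :
    distPoly b μ t (flipSet P j S) = distPoly b μ t S := by
  have hinv (w : P.weylGroup) : simpleRefl b j * (simpleRefl b j * w) = w := by
    rw [← mul_assoc, simpleRefl_mul_self, one_mul]
  refine Finset.sum_nbij' (simpleRefl b j * ·) (simpleRefl b j * ·)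
    (fun w hw ↦ simpleRefl_mul_mem_stab hj hw) (fun w hw ↦ simpleRefl_mul_mem_stab hj hw)
    (fun w _ ↦ hinv w) (fun w _ ↦ hinv w) fun w hw ↦ ?_
  have h1 : flipSet P j S ∆ inversions b w =
      (S ∆ inversions b (simpleRefl b j * w)).image (posPerm P j) := by
    rw [← flipSet_symmDiff_flipSet, ← inversions_simpleRefl_mul, hinv]
  rw [h1, Finset.prod_image (posPerm P j).injective.injOn]
  refine Finset.prod_congr rfl fun a ha ↦ ?_
  have ha' : a ∈ stabPos b μ := by
    have := inversions_subset_stabPos hμ (simpleRefl_mul_mem_stab hj hw)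
    rw [Finset.mem_symmDiff] at ha
    rcases ha with ha | ha
    · exact hS ha.1
    · exact this ha.1
  by_cases haj : a = j
  · subst haj; rw [posPerm_self]
  · rw [posPerm_of_isPos j.2 (mem_stabPos.mp ha').1 haj, ← perm_ofIdx, ht]

theorem coreflection_add_coroot_involutive (j : ι) (σ : Y) :
    P.coreflection j (P.coreflection j σ + P.coroot j) + P.coroot j = σ := by
  rw [map_add, RootPairing.coreflection_apply_self, RootPairing.coreflection_same,
    neg_add_cancel_right]

theorem flipSet_mem_fiber {j : b.support} (hj : P.toLinearMap μ (P.coroot j) = 0) {σ : Y}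
    {S : Finset ι}
    (hS : S ∈ (stabPos b μ).powerset.filter fun S ↦ ∑ a ∈ S, P.coroot a = σ) :
    flipSet P j S ∈ (stabPos b μ).powerset.filter fun S ↦
      ∑ a ∈ S, P.coroot a = P.coreflection j σ + P.coroot j := by
  rw [Finset.mem_filter, Finset.mem_powerset] at hS ⊢
  refine ⟨flipSet_subset_stabPos hj hS.1, ?_⟩
  rw [sum_coroot_flipSet fun a ha ↦ (mem_stabPos.mp (hS.1 ha)).1, hS.2]

theorem identityCoeff_reflect (ht : ∀ (w : P.weylGroup) a, t (P.weylGroupToPerm w a) = t a)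
    (hμ : IsDominant b μ) {j : b.support} (hj : P.toLinearMap μ (P.coroot j) = 0) (σ : Y) :
    identityCoeff b μ t (P.coreflection j σ + P.coroot j) = -identityCoeff b μ t σ := by
  rw [identityCoeff, identityCoeff, ← Finset.sum_neg_distrib]
  refine (Finset.sum_nbij' (flipSet P j) (flipSet P j) (fun S hS ↦ flipSet_mem_fiber hj hS)
    (fun S hS ↦ ?_) (fun S _ ↦ flipSet_flipSet _ S) (fun S _ ↦ flipSet_flipSet _ S)
    fun S hS ↦ ?_).symm
  · have := flipSet_mem_fiber hj hS
    rwa [coreflection_add_coroot_involutive] at this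
  · rw [Finset.mem_filter, Finset.mem_powerset] at hS
    rw [neg_one_pow_card_flipSet, distPoly_flipSet ht hμ hj hS.1, neg_mul]

/-- Antisymmetry would only give `2c = 0`, which says nothing in characteristic 2. Instead the
subsets are cancelled in pairs; no `S` is its own flip, because `j` enters or leaves it. -/
theorem identityCoeff_eq_zero_of_fixed
    (ht : ∀ (w : P.weylGroup) a, t (P.weylGroupToPerm w a) = t a)
    (hμ : IsDominant b μ) {j : b.support} (hj : P.toLinearMap μ (P.coroot j) = 0) {σ : Y}
    (hσ : P.coreflection j σ + P.coroot j = σ) : identityCoeff b μ t σ = 0 := by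
  refine Finset.sum_involution (fun S _ ↦ flipSet P j S) (fun S hS ↦ ?_) (fun S _ _ h ↦ ?_)
    (fun S hS ↦ ?_) (fun S _ ↦ flipSet_flipSet _ S)
  · rw [Finset.mem_filter, Finset.mem_powerset] at hS
    rw [neg_one_pow_card_flipSet, distPoly_flipSet ht hμ hj hS.1]
    ring
  · have := self_mem_flipSet (P := P) (j := j) (S := S)
    rw [h] at this
    tauto
  · have := flipSet_mem_fiber hj hS
    rwa [hσ] at this

theorem two_mul_corootForm_coroot (a : ι) (σ : Y) :
    2 * P.CorootForm (P.coroot a) σ =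
      P.CorootForm (P.coroot a) (P.coroot a) * P.toLinearMap (P.root a) σ := by
  have h := congrArg (fun x ↦ P.toLinearMap x σ) (P.corootForm_self_smul_root a)
  simp only [map_smul, map_nsmul, LinearMap.smul_apply] at h
  rw [RootPairing.toLinearMap_apply_CoPolarization] at h
  simpa using h.symm

/-- A sum of positive coroots of the stabilizer that is antidominant for it is empty. -/
theorem eq_empty_of_antidominant (hμ : IsDominant b μ) {S : Finset ι} (hS : S ⊆ stabPos b μ)
    (h : ∀ j ∈ b.support, P.toLinearMap μ (P.coroot j) = 0 →
      P.toLinearMap (P.root j) (∑ a ∈ S, P.coroot a) ≤ 0) : S = ∅ := by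
  set σ := ∑ a ∈ S, P.coroot a with hσ
  clear_value σ
  have hcoroot (c : ι) : 0 ≤ P.CorootForm (P.coroot c) (P.coroot c) := by
    rw [RootPairing.corootForm_apply_apply]
    exact Finset.sum_nonneg fun _ _ ↦ mul_self_nonneg _
  -- Each `a ∈ S` is, up to a positive factor, a nonnegative combination of simple coroots of the
  -- stabilizer, and these pair nonpositively with `σ`.
  have hle : P.CorootForm σ σ ≤ 0 := by
    have hexp : P.CorootForm σ σ = ∑ a ∈ S, P.CorootForm (P.coroot a) σ := by
      have h1 := LinearMap.congr_fun (congrArg P.CorootForm hσ) σ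
      rwa [map_sum, LinearMap.sum_apply] at h1
    rw [hexp]
    refine Finset.sum_nonpos fun a ha ↦ ?_
    obtain ⟨d, m, hd, hm, hm0, hsum⟩ := exists_smul_coroot_eq_sum_stab hμ (hS ha)
    have h1 : d * P.CorootForm (P.coroot a) σ ≤ 0 := by
      rw [← smul_eq_mul, ← LinearMap.smul_apply, ← map_zsmul, hsum, map_sum, LinearMap.sum_apply]
      refine Finset.sum_nonpos fun j hj ↦ ?_
      rw [map_zsmul, LinearMap.smul_apply, smul_eq_mul]
      by_cases hmj : m j = 0
      · simp [hmj]
      · have h2 := two_mul_corootForm_coroot (P := P) j σ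
        have h3 := mul_nonpos_of_nonneg_of_nonpos (hcoroot j) (h j hj (hm0 j hj hmj))
        exact mul_nonpos_of_nonneg_of_nonpos (hm j) (by omega)
    exact nonpos_of_mul_nonpos_right h1 hd
  rw [RootPairing.corootForm_apply_apply] at hle
  -- The form is a sum of squares of pairings with roots, so all of them vanish at `σ`. Then so does
  -- the pairing with `2ρ`, which is positive on every element of `S`.
  have hzero : ∀ c, P.toLinearMap (P.root c) σ = 0 := by
    intro c
    have h1 := (Finset.sum_eq_zero_iff_of_nonneg fun c _ ↦ mul_self_nonneg _).mp
      (hle.antisymm (Finset.sum_nonneg fun c _ ↦ mul_self_nonneg _)) c (Finset.mem_univ c)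
    exact mul_self_eq_zero.mp h1
  have hρ : ∑ a ∈ S, P.toLinearMap (twoRho b) (P.coroot a) = 0 := by
    rw [← map_sum, ← hσ, twoRho, map_sum, LinearMap.sum_apply]
    exact Finset.sum_eq_zero fun c _ ↦ hzero c
  by_contra hne
  exact absurd hρ (Finset.sum_pos (fun a ha ↦ twoRho_pos (mem_stabPos.mp (hS ha)).1)
    (Finset.nonempty_iff_ne_empty.mpr hne)).ne'

theorem identityCoeff_eq_zero (ht : ∀ (w : P.weylGroup) a, t (P.weylGroupToPerm w a) = t a)
    (hμ : IsDominant b μ) (σ : Y) : identityCoeff b μ t σ = 0 := by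
  -- Induction on the pairing with `2ρ`. Below zero no subset of positive coroots has sum `σ`, which
  -- settles the base case.
  suffices H : ∀ (n : ℕ) (σ : Y), P.toLinearMap (twoRho b) σ < n → identityCoeff b μ t σ = 0 from
    H ((P.toLinearMap (twoRho b) σ).toNat + 1) σ (by push_cast; omega)
  intro n
  induction n with
  | zero =>
    intro σ hσ
    refine Finset.sum_eq_zero fun S hS ↦ ?_
    rw [Finset.mem_filter, Finset.mem_powerset] at hS
    rw [← hS.2, map_sum] at hσ
    exact absurd hσ (not_lt.mpr (by
      push_cast
      exact Finset.sum_nonneg fun a ha ↦ (twoRho_pos (mem_stabPos.mp (hS.1 ha)).1).le))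
  | succ n ih =>
    intro σ hσ
    by_cases hex : ∃ j : b.support, P.toLinearMap μ (P.coroot j) = 0 ∧
        0 < P.toLinearMap (P.root j) σ
    · obtain ⟨j, hj, hjσ⟩ := hex
      have hdot : P.coreflection j σ + P.coroot j =
          σ + (1 - P.toLinearMap (P.root j) σ) • P.coroot j := by
        rw [RootPairing.coreflection_apply, sub_smul, one_smul]
        change σ - P.toLinearMap (P.root j) σ • P.coroot j + P.coroot j = _
        abel
      by_cases h1 : P.toLinearMap (P.root j) σ = 1
      · refine identityCoeff_eq_zero_of_fixed ht hμ hj ?_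
        rw [hdot, h1, sub_self, zero_smul, add_zero]
      -- Here `⟨α_j, σ⟩ ≥ 2`, so the shifted reflection subtracts a positive multiple of `α_j^∨` and
      -- lowers the pairing with `2ρ`.
      · rw [← neg_eq_zero, ← identityCoeff_reflect ht hμ hj, ih]
        rw [hdot, map_add, map_zsmul, twoRho_simple, smul_eq_mul]
        push_cast at hσ
        omega
    · push Not at hex
      refine Finset.sum_eq_zero fun S hS ↦ ?_
      rw [Finset.mem_filter, Finset.mem_powerset] at hS
      obtain rfl := eq_empty_of_antidominant hμ hS.1
        fun j hj hj0 ↦ by rw [hS.2]; exact hex ⟨j, hj⟩ hj0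
      simp

/-- Macdonald's identity for the Poincaré polynomial of the stabilizer of `μ`, evaluated at a
character `χ` of the coroot lattice. -/
theorem sum_stab_prod_eq (ht : ∀ (w : P.weylGroup) a, t (P.weylGroupToPerm w a) = t a)
    (hμ : IsDominant b μ) (χ : Multiplicative Y →* K) :
    ∑ w ∈ stab P μ, ∏ a ∈ stabPos b μ,
        (if a ∈ inversions b w then t a - χ (.ofAdd (P.coroot a))
          else 1 - χ (.ofAdd (P.coroot a)) * t a) =
      (∑ w ∈ stab P μ, ∏ a ∈ inversions b w, t a) *
        ∏ a ∈ stabPos b μ, (1 - χ (.ofAdd (P.coroot a))) := by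
  have hχ (S : Finset ι) : ∏ a ∈ S, χ (.ofAdd (P.coroot a)) =
      χ (.ofAdd (∑ a ∈ S, P.coroot a)) := by
    rw [ofAdd_sum, map_prod]
  have hleft (w : P.weylGroup) (hw : w ∈ stab P μ) :
      ∏ a ∈ stabPos b μ, (if a ∈ inversions b w then t a - χ (.ofAdd (P.coroot a))
          else 1 - χ (.ofAdd (P.coroot a)) * t a) =
        ∑ S ∈ (stabPos b μ).powerset, (-1) ^ S.card * χ (.ofAdd (∑ a ∈ S, P.coroot a)) *
          ∏ a ∈ S ∆ inversions b w, t a := by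
    have hsplit : ∀ a ∈ stabPos b μ,
        (if a ∈ inversions b w then t a - χ (.ofAdd (P.coroot a))
          else 1 - χ (.ofAdd (P.coroot a)) * t a) =
        -1 * χ (.ofAdd (P.coroot a)) * (if a ∈ inversions b w then 1 else t a) +
          if a ∈ inversions b w then t a else 1 := by
      intro a _
      split_ifs <;> ring
    rw [Finset.prod_congr rfl hsplit, Finset.prod_add]
    refine Finset.sum_congr rfl fun S hS ↦ ?_
    rw [Finset.mem_powerset] at hS
    rw [Finset.prod_mul_distrib, Finset.prod_mul_distrib, Finset.prod_const, hχ, mul_assoc]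
    congr 1
    -- The factors `t_a` with `a ∈ S \ 𝓛(w)` come from the first summand of `hsplit`, those with `a
    -- ∈ 𝓛(w) \ S` from the second.
    rw [symmDiff_def, Finset.sup_eq_union, Finset.prod_union disjoint_sdiff_sdiff,
      Finset.prod_ite, Finset.prod_ite, Finset.prod_const_one, Finset.prod_const_one, one_mul,
      mul_one, Finset.filter_notMem_eq_sdiff, Finset.filter_mem_eq_inter]
    congr 1
    refine Finset.prod_congr ?_ fun _ _ ↦ rfl
    have := inversions_subset_stabPos hμ hw
    ext a
    simp only [Finset.mem_inter, Finset.mem_sdiff]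
    constructor
    · tauto
    · rintro ⟨h1, h2⟩
      exact ⟨⟨this h1, h2⟩, h1⟩
  have hright : ∏ a ∈ stabPos b μ, (1 - χ (.ofAdd (P.coroot a))) =
      ∑ S ∈ (stabPos b μ).powerset, (-1) ^ S.card * χ (.ofAdd (∑ a ∈ S, P.coroot a)) := by
    have hsplit : ∀ a ∈ stabPos b μ, 1 - χ (.ofAdd (P.coroot a)) =
        -1 * χ (.ofAdd (P.coroot a)) + 1 := fun a _ ↦ by ring
    rw [Finset.prod_congr rfl hsplit, Finset.prod_add]
    refine Finset.sum_congr rfl fun S _ ↦ ?_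
    rw [Finset.prod_mul_distrib, Finset.prod_const, hχ, Finset.prod_const_one, mul_one]
  have hempty : ∑ w ∈ stab P μ, ∏ a ∈ inversions b w, t a = distPoly b μ t ∅ := by
    simp only [distPoly, ← Finset.bot_eq_empty, bot_symmDiff]
  -- Group the difference of the two sides by `σ = ΣS`; each group is `χ(σ)` times the vanishing
  -- `identityCoeff`.
  rw [Finset.sum_congr rfl hleft, Finset.sum_comm, hright, hempty, ← sub_eq_zero, Finset.mul_sum,
    ← Finset.sum_sub_distrib,
    ← Finset.sum_fiberwise_of_maps_to (t := (stabPos b μ).powerset.image fun S ↦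
      ∑ a ∈ S, P.coroot a) fun S hS ↦ Finset.mem_image_of_mem _ hS]
  refine Finset.sum_eq_zero fun σ _ ↦ ?_
  rw [← mul_zero (χ (.ofAdd σ)), ← identityCoeff_eq_zero ht hμ σ, identityCoeff, Finset.mul_sum]
  refine Finset.sum_congr rfl fun S hS ↦ ?_
  rw [(Finset.mem_filter.mp hS).2, ← Finset.mul_sum, ← distPoly]
  ring

end Identity

/-! ### Reduction of the stated sum to Macdonald's identity -/

theorem sep_one_left (b : P.Base) (w : P.weylGroup) : sep b 1 w = inversions b w := by
  simp [sep, inversions_one]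

theorem sep_eq_sdiff {b : P.Base} {v w : P.weylGroup} (h : inversions b v ⊆ inversions b w) :
    sep b v w = inversions b w \ inversions b v := by
  rw [sep, Finset.union_eq_right.mpr h, Finset.inter_eq_left.mpr h]

/-- The character `y ↦ t^{ht(-y)}` of the coweight lattice. -/
noncomputable def negHeightChar (b : P.Base) (s : b.support → K)
    (h0 : ∀ a, tRootHalf b s a ≠ 0) : Multiplicative Y →* K where
  toFun y := tHeight b s (-y.toAdd)
  map_one' := by rw [toAdd_one, neg_zero, tHeight_zero]
  map_mul' y z := by rw [toAdd_mul, neg_add, tHeight_add h0]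

/-- Splitting off the common denominators and half powers of the parameters. -/
theorem prod_mul_prod_sdiff_eq {N L : Finset ι} (hL : L ⊆ N) {r y : ι → K}
    (hr : ∀ a, r a ≠ 0) :
    (∏ a ∈ L, r a * ((1 - y a * (r a ^ 2)⁻¹) / (1 - y a))) *
        ∏ a ∈ N \ L, (r a)⁻¹ * ((1 - y a * r a ^ 2) / (1 - y a)) =
      (∏ a ∈ N, r a)⁻¹ * ((∏ a ∈ N, if a ∈ L then r a ^ 2 - y a else 1 - y a * r a ^ 2) /
        ∏ a ∈ N, (1 - y a)) := by
  rw [← Finset.prod_inv_distrib, ← Finset.prod_div_distrib, ← Finset.prod_mul_distrib,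
    ← Finset.prod_sdiff hL, mul_comm]
  congr 1 <;> refine Finset.prod_congr rfl fun a ha ↦ ?_
  · rw [if_neg (Finset.mem_sdiff.mp ha).2]
  · rw [if_pos ha]
    have := hr a
    rw [← mul_div_assoc, ← mul_div_assoc]
    congr 1
    field_simp

end MacdonaldPoincare

open MacdonaldPoincare in
theorem lemma3p5 {ι X Y K : Type*} [Fintype ι] [AddCommGroup X] [AddCommGroup Y]
    [Module.Free ℤ X] [Module.Finite ℤ X] [Module.Free ℤ Y] [Module.Finite ℤ Y] [Field K]
    (P : RootDatum ι X Y) [P.IsReduced] (b : P.Base)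
    -- the square roots of the parameters
    (s : b.support → K) (hs0 : ∀ i, s i ≠ 0)
    (hs : ∀ i j, IsConj (simpleRefl b i) (simpleRefl b j) → s i = s j)
    (μ : X) (hμ : IsDominant b μ)
    (wμ : P.weylGroup) (hwμ : IsLongestInStab b μ wμ)
    -- the denominators that occur do not vanish
    (hden : ∀ a ∈ sep b 1 wμ, 1 - tHeight b s (-P.coroot a) ≠ 0) :
    ∑ u ∈ stab P μ,
        (∏ a ∈ sep b 1 u, tRootHalf b s a *
          ((1 - tHeight b s (-P.coroot a) * (tRoot b s a)⁻¹) /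
            (1 - tHeight b s (-P.coroot a)))) *
        (∏ a ∈ sep b u wμ, (tRootHalf b s a)⁻¹ *
          ((1 - tHeight b s (-P.coroot a) * tRoot b s a) /
            (1 - tHeight b s (-P.coroot a)))) =
      (tWeylHalf b s wμ)⁻¹ * poincare b s μ := by
  classical
  have h0 := tRootHalf_ne_zero hs hs0
  have hN := hwμ.inversions_eq hμ
  have hterm : ∀ u ∈ stab P μ,
      (∏ a ∈ sep b 1 u, tRootHalf b s a *
          ((1 - tHeight b s (-P.coroot a) * (tRoot b s a)⁻¹) /
            (1 - tHeight b s (-P.coroot a)))) *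
        (∏ a ∈ sep b u wμ, (tRootHalf b s a)⁻¹ *
          ((1 - tHeight b s (-P.coroot a) * tRoot b s a) /
            (1 - tHeight b s (-P.coroot a)))) =
      (∏ a ∈ stabPos b μ, tRootHalf b s a)⁻¹ *
        ((∏ a ∈ stabPos b μ, if a ∈ inversions b u then tRoot b s a - tHeight b s (-P.coroot a)
          else 1 - tHeight b s (-P.coroot a) * tRoot b s a) /
        ∏ a ∈ stabPos b μ, (1 - tHeight b s (-P.coroot a))) := by
    intro u hu
    have hsub := inversions_subset_stabPos hμ hu
    rw [sep_one_left, sep_eq_sdiff (hN ▸ hsub), hN]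
    exact prod_mul_prod_sdiff_eq hsub h0
  have hmain := sum_stab_prod_eq (t := tRoot b s)
    (fun w a ↦ by rw [tRoot, tRoot, tRootHalf_perm hs]) hμ (negHeightChar b s h0)
  have hne : ∏ a ∈ stabPos b μ, (1 - tHeight b s (-P.coroot a)) ≠ 0 := by
    rw [Finset.prod_ne_zero_iff, ← hN, ← sep_one_left]
    exact hden
  rw [Finset.sum_congr rfl hterm, ← Finset.mul_sum, ← Finset.sum_div, tWeylHalf_eq_prod hs, hN,
    poincare, Finset.sum_congr rfl fun u _ ↦ tWeyl_eq_prod hs u]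
  congr 1
  -- Only here must the denominators be nonzero: the common one is cleared, leaving Macdonald's
  -- identity.
  rw [div_eq_iff hne]
  exact hmain
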